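/- Let $\mathbb{k}\in\{\mathbb{R},\mathbb{C}\}$, let $\mathbb{F}_d$ be the free group on $s_1,\dots,s_d$, let $H$ be a Hilbert space over $\mathbb{k}$, and let $\mathbb{B}(H)[\mathbb{F}_d]$ be the group algebra of finitely supported functions $f:\mathbb{F}_d\to\mathbb{B}(H)$, with the convolution product $(f*g)(s)=\sum_t f(st^{-1})g(t)$ and the involution $f^*(s)=f(s^{-1})^*$. Call $E\subset\mathbb{F}_d$ grounded if $1\in E$ and $E$ is connected in the Cayley graph in which $s,t$ are adjacent iff $st^{-1}\in\{s_1^{\pm1},\dots,s_d^{\pm1}\}$. (1) Let $f=f^*\in\mathbb{B}(H)[\mathbb{F}_d]$ and let $E\subset\mathbb{F}_d$ be grounded with $\operatorname{supp} f\subset E^{-1}E$. Assume that $(\mathrm{id}\otimes\pi)(f)=\sum_{a} f(a)\otimes\pi(a)\ge 0$ for every finite-dimensional unitary representation $\pi$ of $\mathbb{F}_d$ over $\mathbb{k}$ of dimension at most $2|E|\dim H$ (no restriction on the finite dimension of $\pi$ if $H\neq 0$ and $|E|$ or $\dim H$ is infinite). Then there are an integer $n\le|E|$ and $\xi_1,\dots,\xi_n\in\mathbb{B}(H)[\mathbb{F}_d]$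 with $\operatorname{supp}\xi_i\subset E$ such that $f=\sum_{i=1}^n\xi_i^**\xi_i$. If $\dim H=\infty$, one may take $n=1$. (2) Consequently, the cone $\mathbb{k}[\mathbb{F}_d]_+=\{\sum_{i=1}^n\xi_i^**\xi_i : n\in\mathbb{N},\ \xi_i\in\mathbb{k}[\mathbb{F}_d]\}$ is archimedean closed: for $a=a^*\in\mathbb{k}[\mathbb{F}_d]$, if $a+\varepsilon 1\in\mathbb{k}[\mathbb{F}_d]_+$ for every $\varepsilon>0$, then $a\in\mathbb{k}[\mathbb{F}_d]_+$. -/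

import Mathlib

open scoped TensorProduct Pointwise

noncomputable section

/-- The involution of the group algebra `R[G]` over a star ring `R`: `f^*(s) = f(s⁻¹)^*`. -/
instance groupAlgebraStar {R G : Type*} [Semiring R] [StarRing R] [Group G] :
    Star (MonoidAlgebra R G) where
  star f := MonoidAlgebra.ofCoeff
    ((f.coeff.mapRange star (star_zero R)).equivMapDomain (Equiv.inv G))

theorem groupAlgebra_coeff_star {R G : Type*} [Semiring R] [StarRing R] [Group G]
    (f : MonoidAlgebra R G) (s : G) : (star f).coeff s = star (f.coeff s⁻¹) := by
  simp [star]

theorem groupAlgebra_star_add {R G : Type*} [Semiring R] [StarRing R] [Group G]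
    (f g : MonoidAlgebra R G) : star (f + g) = star f + star g := by
  ext s
  simp [groupAlgebra_coeff_star]

theorem groupAlgebra_star_zero {R G : Type*} [Semiring R] [StarRing R] [Group G] :
    star (0 : MonoidAlgebra R G) = 0 := by
  ext s
  simp [groupAlgebra_coeff_star]

theorem groupAlgebra_star_single {R G : Type*} [Semiring R] [StarRing R] [Group G]
    (a : G) (r : R) :
    star (MonoidAlgebra.single a r) = MonoidAlgebra.single a⁻¹ (star r) := by
  classical
  ext s
  rw [groupAlgebra_coeff_star, MonoidAlgebra.coeff_single, MonoidAlgebra.coeff_single,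
    Finsupp.single_apply, Finsupp.single_apply]
  by_cases h : a = s⁻¹
  · simp [h]
  · rw [if_neg h, if_neg (fun h' => h (by simp [← h'])), star_zero]

/-- With this involution the group algebra is a `*`-ring. -/
instance groupAlgebraStarRing {R G : Type*} [Semiring R] [StarRing R] [Group G] :
    StarRing (MonoidAlgebra R G) where
  star_involutive f := by
    ext s
    simp [groupAlgebra_coeff_star]
  star_add := groupAlgebra_star_add
  star_mul f g := by
    induction f using MonoidAlgebra.induction_linear with
    | zero => simp [groupAlgebra_star_zero]
    | add f₁ f₂ h₁ h₂ => rw [add_mul, groupAlgebra_star_add, h₁, h₂, groupAlgebra_star_add, mul_add]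
    | single a r =>
      induction g using MonoidAlgebra.induction_linear with
      | zero => simp [groupAlgebra_star_zero]
      | add g₁ g₂ h₁ h₂ =>
        rw [mul_add, groupAlgebra_star_add, h₁, h₂, groupAlgebra_star_add, add_mul]
      | single b t =>
        simp only [groupAlgebra_star_single, MonoidAlgebra.single_mul_single, star_mul,
          mul_inv_rev]

/-- The Cayley graph of the free group of rank `d`: `s` and `t` are adjacent iff
`s t⁻¹` is a canonical generator or the inverse of one. -/
def freeCayleyGraph (d : ℕ) : SimpleGraph (FreeGroup (Fin d)) where
  Adj s t := ∃ i : Fin d, s * t⁻¹ = FreeGroup.of i ∨ s * t⁻¹ = (FreeGroup.of i)⁻¹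
  symm := ⟨by
    rintro s t ⟨i, h | h⟩
    · exact ⟨i, Or.inr (by rw [← h]; group)⟩
    · exact ⟨i, Or.inl (by rw [← inv_inv (FreeGroup.of i), ← h]; group)⟩⟩
  loopless := ⟨by
    rintro s ⟨i, h | h⟩
    · rw [mul_inv_cancel] at h
      exact FreeGroup.of_ne_one i h.symm
    · rw [mul_inv_cancel] at h
      exact FreeGroup.of_ne_one i (inv_eq_one.mp h.symm)⟩

/-- A subset of the free group is grounded if it contains the unit and is connected in the
Cayley graph. -/
def IsGrounded {d : ℕ} (E : Set (FreeGroup (Fin d))) : Prop :=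
  1 ∈ E ∧ ((freeCayleyGraph d).induce E).Connected

/-- The operator `(id ⊗ π)(f) = ∑ₐ f(a) ⊗ π(a)` on `H ⊗ K`, for `f ∈ B(H)[G]` and a unitary
representation `π` of `G` on `K`. For finite-dimensional `K` the algebraic tensor product
`H ⊗ K` is already the Hilbert space tensor product. -/
def evalRep {𝕜 G H K : Type*} [RCLike 𝕜] [Group G]
    [NormedAddCommGroup H] [InnerProductSpace 𝕜 H]
    [NormedAddCommGroup K] [InnerProductSpace 𝕜 K] [CompleteSpace K]
    (π : G →* unitary (K →L[𝕜] K)) (f : MonoidAlgebra (H →L[𝕜] H) G) :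
    (H ⊗[𝕜] K) →ₗ[𝕜] (H ⊗[𝕜] K) :=
  ∑ a ∈ f.coeff.support,
    TensorProduct.map (f.coeff a : H →ₗ[𝕜] H) ((π a : K →L[𝕜] K) : K →ₗ[𝕜] K)

/-- The cone of finite sums of hermitian squares `∑ ξᵢ^* ξᵢ`. -/
def sosCone (A : Type*) [Semiring A] [StarRing A] : Set A :=
  {a | ∃ (n : ℕ) (ξ : Fin n → A), a = ∑ i, star (ξ i) * ξ i}

/-- The archimedean closure of a cone `C`: the hermitian `a` with `a + ε 1 ∈ C` for all
real `ε > 0`. -/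
def archClosure (𝕜 : Type*) {A : Type*} [RCLike 𝕜] [Semiring A] [StarRing A] [Module 𝕜 A]
    (C : Set A) : Set A :=
  {a | IsSelfAdjoint a ∧ ∀ ε : ℝ, 0 < ε → a + (ε : 𝕜) • (1 : A) ∈ C}

/-- A cone is archimedean closed if it equals its archimedean closure. -/
def IsArchClosed (𝕜 : Type*) {A : Type*} [RCLike 𝕜] [Semiring A] [StarRing A] [Module 𝕜 A]
    (C : Set A) : Prop :=
  C = archClosure 𝕜 C

end

/-! The core is a duality argument for block matrices. For finite `E` and scalar blocks, writing `f`
as a sum of squares supported on `E` means finding a positive semidefinite matrix `T` on `E × Fin k`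
whose sums along the fibres of `(x, y) ↦ x⁻¹ y` are the coefficients of `f`. The fibre over `1` is
the diagonal, so it controls the trace; hence the attainable coefficients form a closed convex cone,
and a non-attainable `f` is separated from it by a functional. Up to taking a hermitian part, that
functional is a positive semidefinite block Toeplitz matrix, that is, a family of vectors `g x i`
whose Gram matrix depends only on `x⁻¹ y`. Left translation by a generator is then a partial
isometry on these vectors and extends to a unitary. Since the group is free these unitaries define a
representation, and since `E` is connected and contains `1` the family is the orbit of the `g 1 i`.
Positivity of `f` in this representation contradicts the separation (`IsRooted.exists_rep`,
`IsRooted.exists_gram`).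

For general `H` this is applied to the compressions of `f` to finite-dimensional subspaces. The Gram
forms are bounded uniformly by the coefficient at `1`, so an ultrafilter limit yields a positive
operator on `H^E`; the rows of its square root are the `ξᵢ` (`IsRooted.exists_factorization`). When
`dim H = ∞`, isometries with orthogonal ranges merge the squares into one. Archimedean closedness
follows because positivity in representations survives `ε → 0`, whatever the squares for each `ε`
look like. -/

/-! ### Hilbert space tools: unitary extension, square roots, limits of forms, isometries -/

/-- Two families with the same Gram matrix in a finite-dimensional inner product space differ
by a unitary operator. -/
theorem exists_unitary_of_inner_eq {𝕜 V ι : Type*} [RCLike 𝕜] [NormedAddCommGroup V]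
    [InnerProductSpace 𝕜 V] [FiniteDimensional 𝕜 V] [CompleteSpace V] (v w : ι → V)
    (h : ∀ i j, inner 𝕜 (v i) (v j) = inner 𝕜 (w i) (w j)) :
    ∃ U : unitary (V →L[𝕜] V), ∀ i, (U : V →L[𝕜] V) (v i) = w i := by
  classical
  set A := Finsupp.linearCombination 𝕜 v with hA
  set B := Finsupp.linearCombination 𝕜 w with hB
  have hAB : ∀ c, ‖A c‖ = ‖B c‖ := by
    intro c
    have : inner 𝕜 (A c) (A c) = inner 𝕜 (B c) (B c) := by
      simp only [hA, hB, Finsupp.linearCombination_apply, Finsupp.sum, sum_inner, inner_sum,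
        inner_smul_left, inner_smul_right, h]
    rw [@norm_eq_sqrt_re_inner 𝕜, @norm_eq_sqrt_re_inner 𝕜 _ _ _ _ (B c), this]
  obtain ⟨g, hg⟩ := A.rangeRestrict.exists_rightInverse_of_surjective A.range_rangeRestrict
  have hg' : ∀ y, A (g y) = y := fun y => by
    have := LinearMap.congr_fun hg y
    exact congrArg Subtype.val this
  -- Equal norms make `A c ↦ B c` a well-defined isometry on the span of `v`; finite dimension lets
  -- it extend to a unitary of `V`.
  let T : A.range →ₗᵢ[𝕜] V := ⟨B ∘ₗ g, fun y => by
    rw [LinearMap.comp_apply, ← hAB, hg']; rfl⟩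
  let W : V ≃ₗᵢ[𝕜] V := T.extend.toLinearIsometryEquiv rfl
  refine ⟨Unitary.linearIsometryEquiv.symm W, fun i => ?_⟩
  have hv : v i = A (Finsupp.single i 1) := by simp [hA]
  have hw : w i = B (Finsupp.single i 1) := by simp [hB]
  have hmem : A (Finsupp.single i 1) ∈ A.range := ⟨_, rfl⟩
  have h1 : W (v i) = T ⟨A (Finsupp.single i 1), hmem⟩ := by
    rw [hv]
    exact T.extend_apply ⟨_, hmem⟩
  have h2 : T ⟨A (Finsupp.single i 1), hmem⟩ = B (Finsupp.single i 1) := by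
    change B (g _) = _
    rw [← sub_eq_zero, ← map_sub, ← norm_eq_zero, ← hAB, map_sub, hg', sub_self, norm_zero]
  simpa [hw, ← h2] using h1

/-- In a Banach algebra, `1 - a` is a square whenever `‖a‖ ≤ 1`; the root is a limit of real
polynomials in `a`, hence lies in every closed set stable under the iteration. -/
theorem exists_sq_eq_one_sub {𝕜 A : Type*} [RCLike 𝕜] [NormedRing A] [NormedAlgebra 𝕜 A] [CompleteSpace A]
    (a : A) (ha : ‖a‖ ≤ 1) (S : Set A) (hS : IsClosed S) (h0 : (0 : A) ∈ S)
    (hstep : ∀ y ∈ S, (2⁻¹ : 𝕜) • (a + y * y) ∈ S) :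
    ∃ y ∈ S, (1 - y) * (1 - y) = 1 - a := by
  have h2n : ‖(2⁻¹ : 𝕜)‖ = 2⁻¹ := by simp
  have h2s : (2⁻¹ : 𝕜) + 2⁻¹ = 1 := by norm_num
  let y : ℕ → A := fun n => Nat.rec 0 (fun _ y => (2⁻¹ : 𝕜) • (a + y * y)) n
  -- The same iteration with `a` replaced by `1`: it increases, stays below `1`, and dominates both
  -- `‖y n‖` and the increments of `y`.
  let z : ℕ → ℝ := fun n => Nat.rec 0 (fun _ z => 2⁻¹ * (1 + z * z)) n
  have hy : ∀ n, y (n + 1) = (2⁻¹ : 𝕜) • (a + y n * y n) := fun n => rfl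
  have hz : ∀ n, z (n + 1) = 2⁻¹ * (1 + z n * z n) := fun n => rfl
  have hz0 : ∀ n, 0 ≤ z n ∧ z n ≤ 1 := by
    intro n
    induction n with
    | zero => exact ⟨le_rfl, zero_le_one⟩
    | succ n ih => rw [hz]; constructor <;> nlinarith
  have hzm : Monotone z := monotone_nat_of_le_succ fun n => by
    rw [hz]; nlinarith [sq_nonneg (1 - z n)]
  have hyz : ∀ n, ‖y n‖ ≤ z n := by
    intro n
    induction n with
    | zero => simp [y, z]
    | succ n ih =>
      rw [hy, hz, norm_smul, h2n]
      have := norm_add_le a (y n * y n)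
      have := norm_mul_le (y n) (y n)
      have := mul_le_mul ih ih (norm_nonneg _) (hz0 n).1
      linarith
  have hd : ∀ n, ‖y (n + 1) - y n‖ ≤ z (n + 1) - z n := by
    intro n
    induction n with
    | zero =>
      have : ‖(2⁻¹ : 𝕜) • a‖ ≤ 2⁻¹ := by
        rw [norm_smul, h2n]; linarith
      simpa [y, z] using this
    | succ n ih =>
      have e : y (n + 1 + 1) - y (n + 1) = (2⁻¹ : 𝕜) •
          (y (n + 1) * (y (n + 1) - y n) + (y (n + 1) - y n) * y n) := by
        rw [hy (n + 1), hy n, ← smul_sub]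
        congr 1
        rw [← hy n]
        noncomm_ring
      have e' : z (n + 1 + 1) - z (n + 1) =
          2⁻¹ * (z (n + 1) * (z (n + 1) - z n) + (z (n + 1) - z n) * z n) := by
        rw [hz (n + 1), hz n, ← hz n]; ring
      rw [e, e', norm_smul, h2n]
      gcongr
      refine (norm_add_le _ _).trans (add_le_add ?_ ?_)
      · exact (norm_mul_le _ _).trans
          (mul_le_mul (hyz (n + 1)) ih (norm_nonneg _) (hz0 (n + 1)).1)
      · exact (norm_mul_le _ _).trans
          (mul_le_mul ih (hyz n) (norm_nonneg _) ((norm_nonneg _).trans ih))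
  have hzs : Summable fun n => z (n + 1) - z n := by
    refine summable_of_sum_range_le (c := 1)
      (fun n => sub_nonneg.2 (hzm (Nat.le_succ n))) fun n => ?_
    rw [Finset.sum_range_sub]
    linarith [(hz0 n).2, (hz0 0).1]
  have hc : CauchySeq y := cauchySeq_of_dist_le_of_summable (fun n => z (n + 1) - z n)
    (fun n => by rw [dist_comm, dist_eq_norm]; exact hd n) hzs
  obtain ⟨l, hl⟩ := cauchySeq_tendsto_of_complete hc
  have hmem : ∀ n, y n ∈ S := by
    intro n
    induction n with
    | zero => exact h0
    | succ n ih => exact hstep _ ih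
  refine ⟨l, hS.mem_of_tendsto hl (.of_forall hmem), ?_⟩
  have h1 : Filter.Tendsto (fun n => y (n + 1)) Filter.atTop (nhds l) :=
    hl.comp (Filter.tendsto_add_atTop_nat 1)
  have h2 : Filter.Tendsto (fun n => y (n + 1)) Filter.atTop
      (nhds ((2⁻¹ : 𝕜) • (a + l * l))) := by
    simp only [hy]
    exact ((hl.mul hl).const_add a).const_smul _
  have h3 := tendsto_nhds_unique h1 h2
  have h4 : l + l = a + l * l := by
    conv_lhs => rw [h3, ← add_smul, h2s, one_smul]
  calc (1 - l) * (1 - l) = 1 - (l + l) + l * l := by noncomm_ring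
    _ = 1 - a := by rw [h4]; abel

/-- A bounded positive operator on a real or complex Hilbert space is the square of a
self-adjoint operator. -/
theorem ContinuousLinearMap.IsPositive.exists_isSelfAdjoint_mul_self {𝕜 H : Type*} [RCLike 𝕜]
    [NormedAddCommGroup H] [InnerProductSpace 𝕜 H] [CompleteSpace H] {T : H →L[𝕜] H}
    (hT : T.IsPositive) : ∃ S : H →L[𝕜] H, IsSelfAdjoint S ∧ S * S = T := by
  -- The `+ 1` keeps `c` invertible when `T = 0`. Positivity puts the Rayleigh quotients of `1 - c⁻¹
  -- T` in `[0, 1]`, so this operator is a contraction.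
  obtain ⟨c, hc, hTc⟩ : ∃ c : ℝ, 0 < c ∧ ‖T‖ ≤ c := ⟨‖T‖ + 1, by positivity, by linarith⟩
  have hsa : ∀ r : ℝ, ∀ B : H →L[𝕜] H, IsSelfAdjoint B → IsSelfAdjoint ((r : 𝕜) • B) := by
    intro r B hB
    rw [isSelfAdjoint_iff, star_smul, isSelfAdjoint_iff.1 hB, RCLike.star_def, RCLike.conj_ofReal]
  set a : H →L[𝕜] H := 1 - ((c⁻¹ : ℝ) : 𝕜) • T with ha
  have haS : IsSelfAdjoint a := (IsSelfAdjoint.one _).sub (hsa _ _ hT.isSelfAdjoint)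
  have han : ‖a‖ ≤ 1 := by
    rw [a.norm_eq_iSup_rayleighQuotient (ContinuousLinearMap.isSelfAdjoint_iff_isSymmetric.1 haS)]
    refine Real.iSup_le (fun x => ?_) zero_le_one
    have h1 : a.reApplyInnerSelf x = ‖x‖ ^ 2 - c⁻¹ * T.reApplyInnerSelf x := by
      rw [ContinuousLinearMap.reApplyInnerSelf_apply, ha, sub_apply,
        smul_apply, one_apply_eq_self,
        inner_sub_left, inner_smul_left, RCLike.conj_ofReal, map_sub, RCLike.re_ofReal_mul,
        inner_self_eq_norm_sq, ContinuousLinearMap.reApplyInnerSelf_apply]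
    have h2 := hT.2 x
    have h3 : T.reApplyInnerSelf x ≤ c * ‖x‖ ^ 2 := by
      rw [ContinuousLinearMap.reApplyInnerSelf_apply]
      refine (RCLike.re_le_norm _).trans ((norm_inner_le_norm _ _).trans ?_)
      have := T.le_of_opNorm_le hTc x
      nlinarith [norm_nonneg x]
    have h4 : c⁻¹ * T.reApplyInnerSelf x ≤ ‖x‖ ^ 2 := by
      rw [inv_mul_le_iff₀ hc]; exact h3
    have h5 : 0 ≤ c⁻¹ * T.reApplyInnerSelf x := by positivity
    rw [ContinuousLinearMap.rayleighQuotient, abs_le]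
    constructor
    · refine le_trans (by norm_num) (div_nonneg (by rw [h1]; linarith) (by positivity))
    · refine div_le_one_of_le₀ (by rw [h1]; linarith) (by positivity)
  obtain ⟨y, hyS, hy⟩ := exists_sq_eq_one_sub (𝕜 := 𝕜) a han {B | IsSelfAdjoint B}
    (isClosed_eq continuous_star continuous_id) (IsSelfAdjoint.zero _)
    (fun B hB => by
      have h1 := IsSelfAdjoint.star_mul_self B
      rw [show star B = B from hB] at h1
      have h2 := hsa 2⁻¹ _ (haS.add h1)
      rwa [RCLike.ofReal_inv, RCLike.ofReal_ofNat] at h2)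
  refine ⟨((Real.sqrt c : ℝ) : 𝕜) • (1 - y), hsa _ _ ((IsSelfAdjoint.one _).sub hyS), ?_⟩
  rw [smul_mul_smul_comm, hy, ← RCLike.ofReal_mul, Real.mul_self_sqrt hc.le, ha, sub_sub_cancel,
    smul_smul, ← RCLike.ofReal_mul, mul_inv_cancel₀ hc.ne', RCLike.ofReal_one, one_smul]

/-- An ultrafilter limit of eventually bounded positive semidefinite forms is implemented by a
self-adjoint operator. -/
theorem Ultrafilter.exists_isSelfAdjoint_tendsto_inner {𝕜 H α : Type*} [RCLike 𝕜]
    [NormedAddCommGroup H] [InnerProductSpace 𝕜 H] [CompleteSpace H] (l : Ultrafilter α)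
    {K : α → Type*} [∀ p, NormedAddCommGroup (K p)] [∀ p, InnerProductSpace 𝕜 (K p)]
    (V : ∀ p, H →ₗ[𝕜] K p) (C : ℝ) (hC : ∀ h, ∀ᶠ p in l, ‖V p h‖ ≤ C * ‖h‖) :
    ∃ S : H →L[𝕜] H, IsSelfAdjoint S ∧ ∀ h k,
      Filter.Tendsto (fun p => inner 𝕜 (V p h) (V p k)) l (nhds (inner 𝕜 (S h) (S k))) := by
  have hlim : ∀ h k, ∃ b : 𝕜, ‖b‖ ≤ C * C * ‖h‖ * ‖k‖ ∧
      Filter.Tendsto (fun p => inner 𝕜 (V p h) (V p k)) l (nhds b) := by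
    intro h k
    have hev : ∀ᶠ p in l, inner 𝕜 (V p h) (V p k) ∈
        Metric.closedBall (0 : 𝕜) (C * C * ‖h‖ * ‖k‖) := by
      filter_upwards [hC h, hC k] with p h1 h2
      rw [mem_closedBall_zero_iff]
      calc _ ≤ ‖V p h‖ * ‖V p k‖ := norm_inner_le_norm _ _
        _ ≤ (C * ‖h‖) * (C * ‖k‖) :=
          mul_le_mul h1 h2 (norm_nonneg _) ((norm_nonneg _).trans h1)
        _ = _ := by ring
    obtain ⟨b, hb, hb'⟩ := (isCompact_closedBall (0 : 𝕜) _).ultrafilter_le_nhds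
      (l.map fun p => inner 𝕜 (V p h) (V p k)) (Filter.le_principal_iff.2 hev)
    exact ⟨b, by simpa using hb, hb'⟩
  choose b hb hbl using hlim
  have huniq : ∀ {h k c}, Filter.Tendsto (fun p => inner 𝕜 (V p h) (V p k)) l (nhds c) →
      b h k = c := fun hc => tendsto_nhds_unique (hbl _ _) hc
  let B : H →L⋆[𝕜] H →L[𝕜] 𝕜 := LinearMap.mkContinuous₂
    (LinearMap.mk₂'ₛₗ (starRingEnd 𝕜) (RingHom.id 𝕜) b
      (fun x y z => huniq (by
        simpa only [map_add, inner_add_left] using (hbl x z).add (hbl y z)))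
      (fun c x z => huniq (by
        simpa only [map_smul, inner_smul_left, smul_eq_mul] using (hbl x z).const_mul (starRingEnd 𝕜 c)))
      (fun x y z => huniq (by
        simpa only [map_add, inner_add_right] using (hbl x y).add (hbl x z)))
      (fun c x z => huniq (by
        simpa only [map_smul, inner_smul_right, smul_eq_mul, RingHom.id_apply] using (hbl x z).const_mul c)))
    (C * C) hb
  set T := InnerProductSpace.continuousLinearMapOfBilin B
  have hT : ∀ h k, inner 𝕜 (T h) k = b h k :=
    InnerProductSpace.continuousLinearMapOfBilin_apply B
  have hpos : T.IsPositive := by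
    refine ⟨fun x y => ?_, fun x => ?_⟩
    · change inner 𝕜 (T x) y = inner 𝕜 x (T y)
      rw [hT, ← inner_conj_symm x, hT]
      refine huniq ?_
      have := (RCLike.continuous_conj.tendsto _).comp (hbl y x)
      simpa only [Function.comp_def, inner_conj_symm] using this
    · rw [ContinuousLinearMap.reApplyInnerSelf_apply, hT]
      refine ge_of_tendsto ((RCLike.continuous_re.tendsto _).comp (hbl x x))
        (.of_forall fun p => ?_)
      exact inner_self_nonneg
  obtain ⟨S, hS, hST⟩ := hpos.exists_isSelfAdjoint_mul_self
  refine ⟨S, hS, fun h k => ?_⟩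
  have : inner 𝕜 (S h) (S k) = b h k := by
    rw [← hT, ← hST, mul_apply_eq_comp]
    exact ((ContinuousLinearMap.isSelfAdjoint_iff_isSymmetric.1 hS) (S h) k).symm
  rw [this]
  exact hbl h k

/-- An infinite-dimensional Hilbert space carries any finite number of isometries with pairwise
orthogonal ranges. -/
theorem exists_isometries_of_not_finiteDimensional {𝕜 H : Type*} [RCLike 𝕜]
    [NormedAddCommGroup H] [InnerProductSpace 𝕜 H] [CompleteSpace H]
    (hH : ¬ FiniteDimensional 𝕜 H) (n : ℕ) :
    ∃ W : Fin n → (H →L[𝕜] H), ∀ i j, star (W i) * W j = if i = j then 1 else 0 := by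
  obtain ⟨w, b, -⟩ := exists_hilbertBasis 𝕜 H
  have hw : Infinite w := by
    by_contra hfin
    rw [not_infinite_iff_finite] at hfin
    have := Fintype.ofFinite w
    exact hH b.toOrthonormalBasis.toBasis.finiteDimensional_of_finite
  -- An infinite Hilbert basis contains `n` disjoint copies of itself; `W i` sends the basis onto
  -- the `i`-th copy.
  obtain ⟨e⟩ : Nonempty (w × Fin n ↪ w) := by
    rw [← Cardinal.le_def, Cardinal.mk_prod, Cardinal.mk_fin, Cardinal.lift_natCast, Cardinal.lift_uzero]
    exact Cardinal.mul_le_of_le (Cardinal.aleph0_le_mk w) le_rfl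
      ((Cardinal.natCast_lt_aleph0).le.trans (Cardinal.aleph0_le_mk w))
  have ho : ∀ i, Orthonormal 𝕜 fun k => b (e (k, i)) := fun i =>
    b.orthonormal.comp _ fun k k' h => congrArg Prod.fst (e.injective h)
  let W : Fin n → (H →ₗᵢ[𝕜] H) := fun i =>
    (ho i).orthogonalFamily.linearIsometry.comp b.repr.toLinearIsometry
  have hW : ∀ i h, HasSum (fun k => b.repr h k • b (e (k, i))) (W i h) := fun i h =>
    (ho i).orthogonalFamily.hasSum_linearIsometry (b.repr h)
  refine ⟨fun i => (W i).toContinuousLinearMap, fun i j => ?_⟩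
  ext x
  refine ext_inner_left 𝕜 fun y => ?_
  rw [mul_apply_eq_comp, ContinuousLinearMap.star_eq_adjoint,
    ContinuousLinearMap.adjoint_inner_right]
  change inner 𝕜 (W i y) (W j x) = _
  split_ifs with hij
  · rw [hij, LinearIsometry.inner_map_map]; rfl
  · have h1 : ∀ k, inner 𝕜 (W i y) (b (e (k, j))) = 0 := fun k => by
      have h2 := (hW i y).mapL (innerSL 𝕜 (b (e (k, j))))
      have h3 : ∀ k', innerSL 𝕜 (b (e (k, j))) (b.repr y k' • b (e (k', i))) = 0 := fun k' => by
        rw [innerSL_apply_apply, inner_smul_right, b.orthonormal.2, mul_zero]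
        intro h
        exact hij (congrArg Prod.snd (e.injective h)).symm
      simp only [h3] at h2
      rw [← inner_conj_symm, ← innerSL_apply_apply, h2.unique hasSum_zero, map_zero]
    have h2 := (hW j x).mapL (innerSL 𝕜 (W i y))
    simp only [innerSL_apply_apply, inner_smul_right, h1, mul_zero] at h2
    rw [h2.unique hasSum_zero]
    simp

/-! ### Positive semidefinite matrices: compactness and separation -/

section

open scoped ComplexOrder Matrix MatrixOrder

/-- A positive semidefinite matrix is a Gram matrix. -/
theorem Matrix.PosSemidef.exists_inner_eq {𝕜 n : Type*} [RCLike 𝕜] [Fintype n]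
    {M : Matrix n n 𝕜} (hM : M.PosSemidef) :
    ∃ v : n → EuclideanSpace 𝕜 n, ∀ p q, inner 𝕜 (v p) (v q) = M p q := by
  classical
  obtain ⟨B, rfl⟩ := CStarAlgebra.nonneg_iff_eq_star_mul_self.mp hM.nonneg
  refine ⟨fun p => WithLp.toLp 2 fun r => B r p, fun p q => ?_⟩
  simp [PiLp.inner_apply, Matrix.star_eq_conjTranspose, Matrix.mul_apply, mul_comm]

/-- In Gram form the trace is `∑ ‖v r‖ ^ 2`, and Cauchy–Schwarz bounds each entry. A trace bound
therefore gives compactness. -/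
theorem Matrix.PosSemidef.norm_apply_le_trace {𝕜 n : Type*} [RCLike 𝕜] [Fintype n]
    {M : Matrix n n 𝕜} (hM : M.PosSemidef) (p q : n) : ‖M p q‖ ≤ RCLike.re M.trace := by
  obtain ⟨v, hv⟩ := hM.exists_inner_eq
  have htr : RCLike.re M.trace = ∑ r, ‖v r‖ ^ 2 := by
    simp only [Matrix.trace, Matrix.diag_apply, ← hv, map_sum, inner_self_eq_norm_sq]
  have hle : ∀ r, ‖v r‖ ^ 2 ≤ RCLike.re M.trace := fun r => by
    rw [htr]
    exact Finset.single_le_sum (f := fun r => ‖v r‖ ^ 2) (fun _ _ => sq_nonneg _)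
      (Finset.mem_univ r)
  rw [← hv]
  have := norm_inner_le_norm (𝕜 := 𝕜) (v p) (v q)
  nlinarith [hle p, hle q, sq_nonneg (‖v p‖ - ‖v q‖)]

theorem Matrix.isClosed_setOf_posSemidef {𝕜 n : Type*} [RCLike 𝕜] [Fintype n] :
    IsClosed {M : Matrix n n 𝕜 | M.PosSemidef} := by
  simp only [Matrix.posSemidef_iff_dotProduct_mulVec, Set.ofPred_and, Set.ofPred_forall]
  refine (isClosed_eq (by fun_prop) continuous_id).inter (isClosed_iInter fun x => ?_)
  exact isClosed_le continuous_const (by fun_prop)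

/-- The hermitian part of a matrix with nonnegative real quadratic form is positive
semidefinite. -/
theorem Matrix.posSemidef_add_conjTranspose {𝕜 n : Type*} [RCLike 𝕜] [Fintype n]
    (M : Matrix n n 𝕜) (h : ∀ z : n → 𝕜, 0 ≤ RCLike.re (star z ⬝ᵥ M *ᵥ z)) :
    (M + Mᴴ).PosSemidef := by
  refine .of_dotProduct_mulVec_nonneg (by simp [Matrix.IsHermitian, add_comm]) fun z => ?_
  have h2 : star z ⬝ᵥ Mᴴ *ᵥ z = star (star z ⬝ᵥ M *ᵥ z) := by
    rw [← Matrix.star_dotProduct_star, star_star, Matrix.star_mulVec, ← Matrix.dotProduct_mulVec]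
  rw [Matrix.add_mulVec, dotProduct_add, h2, RCLike.star_def, RCLike.add_conj]
  exact_mod_cast mul_nonneg zero_le_two (h z)

/-- The image of the cone of positive semidefinite matrices is closed under a continuous linear
map which controls the trace. -/
theorem isClosed_image_posSemidef {𝕜 n Y : Type*} [RCLike 𝕜] [Fintype n] [NormedAddCommGroup Y]
    [NormedSpace 𝕜 Y] (L : Matrix n n 𝕜 →ₗ[𝕜] Y) (τ : Y → ℝ) (hτ : Continuous τ)
    (hL : ∀ T, τ (L T) = RCLike.re T.trace) :
    IsClosed (L '' {T | T.PosSemidef}) := by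
  have hLc : Continuous L := L.continuous_of_finiteDimensional
  refine IsSeqClosed.isClosed fun y y₀ hy hy₀ => ?_
  choose T hT hTy using hy
  obtain ⟨R, hR⟩ := ((hτ.tendsto _).comp hy₀).bddAbove_range
  have hK : IsCompact (Set.univ.pi fun _ => Set.univ.pi fun _ => Metric.closedBall (0 : 𝕜) R :
      Set (n → n → 𝕜)) :=
    isCompact_univ_pi fun _ => isCompact_univ_pi fun _ => isCompact_closedBall _ _
  obtain ⟨T₀, -, s, hs, hsT⟩ := @IsCompact.tendsto_subseq (n → n → 𝕜) _ _ _ T hK fun m p _ q _ => by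
    rw [mem_closedBall_zero_iff]
    refine ((hT m).norm_apply_le_trace p q).trans ?_
    rw [← hL, hTy]
    exact hR ⟨m, rfl⟩
  refine ⟨T₀, Matrix.isClosed_setOf_posSemidef.mem_of_tendsto hsT (.of_forall fun m => hT _), ?_⟩
  refine tendsto_nhds_unique ((hLc.tendsto T₀).comp hsT) ?_
  have h1 : (L ∘ fun m => T (s m)) = y ∘ s := funext fun m => hTy (s m)
  exact h1 ▸ hy₀.comp hs.tendsto_atTop

/-- Hahn–Banach applies because the image cone is convex and closed. Homogeneity then improves the
separating constant to `0` on the cone. -/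
theorem exists_separating_of_notMem_image_posSemidef {𝕜 n Y : Type*} [RCLike 𝕜] [Fintype n]
    [NormedAddCommGroup Y] [NormedSpace 𝕜 Y] (L : Matrix n n 𝕜 →ₗ[𝕜] Y) (τ : Y → ℝ)
    (hτ : Continuous τ) (hL : ∀ T, τ (L T) = RCLike.re T.trace) (c : Y)
    (hc : c ∉ L '' {T | T.PosSemidef}) :
    ∃ φ : Y →ₗ[𝕜] 𝕜, RCLike.re (φ c) < 0 ∧
      ∀ T : Matrix n n 𝕜, T.PosSemidef → 0 ≤ RCLike.re (φ (L T)) := by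
  let _ : NormedSpace ℝ Y := NormedSpace.restrictScalars ℝ 𝕜 Y
  have : IsScalarTower ℝ 𝕜 Y := RestrictScalars.isScalarTower ℝ 𝕜 Y
  have hconv : Convex ℝ (L '' {T | T.PosSemidef}) := by
    rintro _ ⟨S, hS, rfl⟩ _ ⟨T, hT, rfl⟩ a b ha hb -
    refine ⟨(a : 𝕜) • S + (b : 𝕜) • T, (hS.smul (by exact_mod_cast ha)).add
      (hT.smul (by exact_mod_cast hb)), ?_⟩
    rw [map_add, map_smul, map_smul]
    rfl
  obtain ⟨φ, u, hu, hφ⟩ := RCLike.geometric_hahn_banach_point_closed (𝕜 := 𝕜) hconv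
    (isClosed_image_posSemidef L τ hτ hL) hc
  have hu0 : u < 0 := by simpa using hφ (L 0) ⟨0, .zero, rfl⟩
  refine ⟨φ, hu.trans hu0, fun T hT => ?_⟩
  -- A negative value could be rescaled to equal `u` exactly, contradicting the strict separation.
  by_contra! hneg
  change RCLike.re (φ (L T)) < 0 at hneg
  have hr : 0 ≤ u / RCLike.re (φ (L T)) := (div_pos_of_neg_of_neg hu0 hneg).le
  have := hφ (L (((u / RCLike.re (φ (L T)) : ℝ) : 𝕜) • T))
    ⟨_, hT.smul (by exact_mod_cast hr), rfl⟩
  rw [map_smul, map_smul, smul_eq_mul, RCLike.re_ofReal_mul, div_mul_cancel₀ _ hneg.ne] at this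
  exact lt_irrefl _ this

/-! ### Rooted sets, translation-invariant Gram matrices and representations -/

/-- A finite set of group elements is rooted if every element is reached from `1` inside the set
along edges of the Cayley graph. -/
def IsRooted {d : ℕ} (E : Finset (FreeGroup (Fin d))) : Prop :=
  1 ∈ E ∧ ∀ p : FreeGroup (Fin d) → Prop, p 1 →
    (∀ x ∈ E, ∀ y ∈ E, (freeCayleyGraph d).Adj x y → p x → p y) → ∀ x ∈ E, p x

/-- Each point of `E` is joined to `1` by a finite path in `E`, and rooted sets are stable under
union because they share the root `1`. This reduces infinite `E` to finite sets. -/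
theorem IsGrounded.exists_isRooted {d : ℕ} {E : Set (FreeGroup (Fin d))} (hE : IsGrounded E)
    (B : Finset (FreeGroup (Fin d))) (hB : (B : Set (FreeGroup (Fin d))) ⊆ E) :
    ∃ E' : Finset (FreeGroup (Fin d)), IsRooted E' ∧ B ⊆ E' ∧
      (E' : Set (FreeGroup (Fin d))) ⊆ E := by
  classical
  have key : ∀ x : E, ∃ E' : Finset (FreeGroup (Fin d)), IsRooted E' ∧ (x : FreeGroup (Fin d)) ∈ E' ∧
      (E' : Set (FreeGroup (Fin d))) ⊆ E := by
    intro x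
    have hreach := hE.2.preconnected ⟨1, hE.1⟩ x
    rw [SimpleGraph.reachable_iff_reflTransGen] at hreach
    induction hreach with
    | refl =>
      refine ⟨{1}, ⟨by simp, fun p h1 _ x hx => ?_⟩, by simp, by simpa using hE.1⟩
      rw [Finset.mem_singleton] at hx
      rwa [hx]
    | @tail y z _ hyz ih =>
      obtain ⟨E', hE', hy, hsub⟩ := ih
      refine ⟨insert z.1 E', ⟨by simp [hE'.1], fun p h1 hp => ?_⟩, by simp, ?_⟩
      · have h2 : ∀ x ∈ E', p x := hE'.2 p h1 fun x hx y hy =>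
          hp x (Finset.mem_insert_of_mem hx) y (Finset.mem_insert_of_mem hy)
        intro x hx
        rcases Finset.mem_insert.1 hx with rfl | hx
        · exact hp y.1 (Finset.mem_insert_of_mem hy) _ (Finset.mem_insert_self _ _) hyz (h2 _ hy)
        · exact h2 x hx
      · rw [Finset.coe_insert, Set.insert_subset_iff]
        exact ⟨z.2, hsub⟩
  induction B using Finset.induction_on with
  | empty =>
    obtain ⟨E', h1, -, h2⟩ := key ⟨1, hE.1⟩
    exact ⟨E', h1, by simp, h2⟩
  | insert b B _ ih =>
    rw [Finset.coe_insert, Set.insert_subset_iff] at hB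
    obtain ⟨E₁, h1, hB1, hs1⟩ := ih hB.2
    obtain ⟨E₂, h2, hb2, hs2⟩ := key ⟨b, hB.1⟩
    refine ⟨E₁ ∪ E₂, ⟨by simp [h1.1], fun p hp hstep x hx => ?_⟩, ?_, ?_⟩
    · rcases Finset.mem_union.1 hx with hx | hx
      · exact h1.2 p hp (fun x hx y hy => hstep x (Finset.mem_union_left _ hx) y
          (Finset.mem_union_left _ hy)) x hx
      · exact h2.2 p hp (fun x hx y hy => hstep x (Finset.mem_union_right _ hx) y
          (Finset.mem_union_right _ hy)) x hx
    · exact Finset.insert_subset (Finset.mem_union_right _ hb2)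
        (hB1.trans Finset.subset_union_left)
    · rw [Finset.coe_union]
      exact Set.union_subset hs1 hs2

/-- Vectors indexed by a rooted set, with Gram matrix invariant under left translation, are an
orbit of a unitary representation of the free group. -/
theorem IsRooted.exists_rep {𝕜 V ι : Type*} [RCLike 𝕜] [NormedAddCommGroup V]
    [InnerProductSpace 𝕜 V] [FiniteDimensional 𝕜 V] [CompleteSpace V] {d : ℕ}
    {E : Finset (FreeGroup (Fin d))} (hE : IsRooted E) (g : FreeGroup (Fin d) → ι → V)
    (hg : ∀ x ∈ E, ∀ y ∈ E, ∀ x' ∈ E, ∀ y' ∈ E, x⁻¹ * y = x'⁻¹ * y' →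
      ∀ i j, inner 𝕜 (g x i) (g y j) = inner 𝕜 (g x' i) (g y' j)) :
    ∃ π : FreeGroup (Fin d) →* unitary (V →L[𝕜] V),
      ∀ x ∈ E, ∀ i, (π x : V →L[𝕜] V) (g 1 i) = g x i := by
  -- Translation by a generator leaves `x⁻¹ y` unchanged, so it preserves the Gram matrix wherever
  -- source and target both lie in `E`. By freeness the unitaries may be chosen independently for
  -- each generator.
  have hU : ∀ l : Fin d, ∃ U : unitary (V →L[𝕜] V), ∀ x ∈ E, FreeGroup.of l * x ∈ E →
      ∀ i, (U : V →L[𝕜] V) (g x i) = g (FreeGroup.of l * x) i := by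
    intro l
    obtain ⟨U, hU⟩ := exists_unitary_of_inner_eq (𝕜 := 𝕜)
      (fun t : {x // x ∈ E ∧ FreeGroup.of l * x ∈ E} × ι => g t.1 t.2)
      (fun t => g (FreeGroup.of l * t.1) t.2) fun s t =>
        hg _ s.1.2.1 _ t.1.2.1 _ s.1.2.2 _ t.1.2.2 (by group) _ _
    exact ⟨U, fun x hx hx' i => hU (⟨x, hx, hx'⟩, i)⟩
  choose U hU using hU
  refine ⟨FreeGroup.lift U, hE.2 _ (by simp) ?_⟩
  rintro x hx y hy ⟨l, h | h⟩ hxp i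
  · obtain rfl : x = FreeGroup.of l * y := by rw [← h]; group
    have h1 := hxp i
    rw [map_mul, FreeGroup.lift_apply_of, ← hU l y hy hx, Submonoid.coe_mul,
      mul_apply_eq_comp] at h1
    have h2 := congrArg (star (U l : V →L[𝕜] V) : V →L[𝕜] V) h1
    have h3 : ∀ v, (star (U l : V →L[𝕜] V) : V →L[𝕜] V) ((U l : V →L[𝕜] V) v) = v := fun v => by
      rw [← mul_apply_eq_comp, Unitary.star_mul_self_of_mem (U l).2]; rfl
    rwa [h3, h3] at h2
  · obtain rfl : y = FreeGroup.of l * x := by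
      rw [← inv_inv (FreeGroup.of l), ← h]; group
    rw [map_mul, FreeGroup.lift_apply_of, Submonoid.coe_mul, mul_apply_eq_comp, hxp i,
      hU l x hx hy]

/-- Summing the entries of a block matrix along the fibres of `(x, y) ↦ x⁻¹ y`. -/
noncomputable def toeplitzSum (𝕜 : Type*) [RCLike 𝕜] {G : Type*} [Group G] [DecidableEq G]
    (E A : Finset G) (k : ℕ) :
    Matrix (E × Fin k) (E × Fin k) 𝕜 →ₗ[𝕜] (A × Fin k × Fin k → 𝕜) where
  toFun T t := ∑ x : E, ∑ y : E, if (x : G)⁻¹ * y = t.1 then T (x, t.2.1) (y, t.2.2) else 0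
  map_add' S T := by
    ext t
    simp only [Matrix.add_apply, Pi.add_apply, ← Finset.sum_add_distrib]
    refine Finset.sum_congr rfl fun x _ => Finset.sum_congr rfl fun y _ => ?_
    split_ifs <;> simp
  map_smul' c T := by
    ext t
    simp only [Matrix.smul_apply, Pi.smul_apply, Finset.smul_sum, smul_ite, smul_zero,
      RingHom.id_apply]

/-- Moment form of the factorization theorem: matrix coefficients which pair nonnegatively with
all unitary representations are block Toeplitz sums of a Gram matrix. -/
theorem IsRooted.exists_gram {𝕜 : Type*} [RCLike 𝕜] {d k : ℕ} {E : Finset (FreeGroup (Fin d))}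
    (hE : IsRooted E) (A : Finset (FreeGroup (Fin d)))
    (hA : ∀ x ∈ E, ∀ y ∈ E, x⁻¹ * y ∈ A) (hA' : ∀ a ∈ A, ∃ x ∈ E, ∃ y ∈ E, x⁻¹ * y = a)
    (c : FreeGroup (Fin d) → Fin k → Fin k → 𝕜)
    (hc : ∀ a i j, c a⁻¹ j i = starRingEnd 𝕜 (c a i j))
    (hpos : ∀ (π : FreeGroup (Fin d) →* unitary (EuclideanSpace 𝕜 (Fin (E.card * k)) →L[𝕜]
        EuclideanSpace 𝕜 (Fin (E.card * k)))) (u : Fin k → EuclideanSpace 𝕜 (Fin (E.card * k))),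
      0 ≤ RCLike.re (∑ a ∈ A, ∑ i, ∑ j, c a i j * inner 𝕜 (u i)
        ((π a : EuclideanSpace 𝕜 (Fin (E.card * k)) →L[𝕜] _) (u j)))) :
    ∃ v : E → Fin k → EuclideanSpace 𝕜 (E × Fin k), ∀ a ∈ A, ∀ i j,
      (∑ x : E, ∑ y : E, if (x : FreeGroup (Fin d))⁻¹ * y = a then inner 𝕜 (v x i) (v y j) else 0)
        = c a i j := by
  have h1A : (1 : FreeGroup (Fin d)) ∈ A := by simpa using hA 1 hE.1 1 hE.1
  have hinvA : ∀ a ∈ A, a⁻¹ ∈ A := fun a ha => by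
    obtain ⟨x, hx, y, hy, rfl⟩ := hA' a ha
    simpa using hA y hy x hx
  by_contra hno
  -- Since `x⁻¹ y = 1` only on the diagonal, the trace of the coefficient at `1` is the full trace
  -- of `T`.
  obtain ⟨φ, hφc, hφ⟩ := exists_separating_of_notMem_image_posSemidef
    (toeplitzSum 𝕜 E A k) (fun y => RCLike.re (∑ i, y (⟨1, h1A⟩, i, i)))
    (by fun_prop) (fun T => by
      congr 1
      simp only [toeplitzSum, LinearMap.coe_mk, AddHom.coe_mk, inv_mul_eq_one, Subtype.coe_inj,
        Finset.sum_ite_eq, Finset.mem_univ, if_true, Matrix.trace, Matrix.diag_apply,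
        Fintype.sum_prod_type]
      exact Finset.sum_comm) (fun t => c t.1 t.2.1 t.2.2) (by
      rintro ⟨T, hT, hTc⟩
      obtain ⟨v, hv⟩ := Matrix.PosSemidef.exists_inner_eq hT
      refine hno ⟨fun x i => v (x, i), fun a ha i j => ?_⟩
      simp only [hv]
      exact congrFun hTc (⟨a, ha⟩, i, j))
  obtain ⟨w, hw⟩ : ∃ w : FreeGroup (Fin d) → Fin k → Fin k → 𝕜, ∀ y : A × Fin k × Fin k → 𝕜,
      φ y = ∑ a : A, ∑ i, ∑ j, y (a, i, j) * w a i j := by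
    refine ⟨fun a i j => if h : a ∈ A then φ (Pi.single (⟨a, h⟩, i, j) 1) else 0, fun y => ?_⟩
    conv_lhs => rw [← Finset.univ_sum_single y]
    simp only [map_sum, Fintype.sum_prod_type]
    refine Finset.sum_congr rfl fun a _ => Finset.sum_congr rfl fun i _ =>
      Finset.sum_congr rfl fun j _ => ?_
    rw [dif_pos a.2, ← smul_eq_mul, ← map_smul, ← Pi.single_smul, smul_eq_mul, mul_one]
  -- The separating functional pulled back to matrices: its coefficients depend only on `x⁻¹ y`.
  let M : Matrix (E × Fin k) (E × Fin k) 𝕜 := fun p q =>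
    w ((p.1 : FreeGroup (Fin d))⁻¹ * q.1) p.2 q.2
  have hφL : ∀ T, φ (toeplitzSum 𝕜 E A k T) = ∑ p, ∑ q, T p q * M p q := by
    intro T
    rw [hw]
    simp only [toeplitzSum, LinearMap.coe_mk, AddHom.coe_mk, Finset.sum_mul, ite_mul, zero_mul]
    have hsplit : ∀ F : E → Fin k → E → Fin k → 𝕜,
        ∑ p : E × Fin k, ∑ q : E × Fin k, F p.1 p.2 q.1 q.2 =
          ∑ i, ∑ j, ∑ x, ∑ y, F x i y j := by
      intro F
      simp only [Fintype.sum_prod_type]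
      rw [Finset.sum_comm]
      refine Finset.sum_congr rfl fun i _ => ?_
      simp only [Finset.sum_comm (s := (Finset.univ : Finset (Fin k)))]
    rw [hsplit (fun x i y j => T (x, i) (y, j) * w ((x : FreeGroup (Fin d))⁻¹ * y) i j),
      Finset.sum_comm]
    refine Finset.sum_congr rfl fun i _ => ?_
    rw [Finset.sum_comm]
    refine Finset.sum_congr rfl fun j _ => ?_
    rw [Finset.sum_comm]
    refine Finset.sum_congr rfl fun x _ => ?_
    rw [Finset.sum_comm]
    refine Finset.sum_congr rfl fun y _ => ?_
    rw [Finset.sum_eq_single ⟨_, hA x x.2 y y.2⟩]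
    · rw [if_pos rfl]
    · intro b _ hb
      rw [if_neg]
      exact fun h => hb (Subtype.ext h.symm)
    · simp
  -- Rank-one matrices `T` turn nonnegativity of the functional into nonnegativity of the quadratic
  -- form of `M`.
  have hG : (M + Mᴴ).PosSemidef := Matrix.posSemidef_add_conjTranspose M fun z => by
    have := hφ _ (Matrix.posSemidef_vecMulVec_star_self z)
    rw [hφL] at this
    convert this using 2
    simp only [dotProduct, Matrix.mulVec, Matrix.vecMulVec_apply, Finset.mul_sum]
    refine Finset.sum_congr rfl fun p _ => Finset.sum_congr rfl fun q _ => by ring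
  obtain ⟨g, hg⟩ := hG.exists_inner_eq
  let e : E × Fin k ≃ Fin (E.card * k) := Fintype.equivFinOfCardEq (by simp)
  let J := LinearIsometryEquiv.piLpCongrLeft 2 𝕜 𝕜 e
  let g' : FreeGroup (Fin d) → Fin k → EuclideanSpace 𝕜 (Fin (E.card * k)) := fun x i =>
    if h : x ∈ E then J (g (⟨x, h⟩, i)) else 0
  have hg' : ∀ x ∈ E, ∀ y ∈ E, ∀ i j, inner 𝕜 (g' x i) (g' y j) =
      w (x⁻¹ * y) i j + starRingEnd 𝕜 (w (x⁻¹ * y)⁻¹ j i) := by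
    intro x hx y hy i j
    simp only [g', dif_pos hx, dif_pos hy]
    rw [LinearIsometryEquiv.inner_map_map, hg, Matrix.add_apply, Matrix.conjTranspose_apply,
      mul_inv_rev, inv_inv]
    rfl
  obtain ⟨π, hπ⟩ := hE.exists_rep (𝕜 := 𝕜) g' fun x hx y hy x' hx' y' hy' h i j => by
    rw [hg' x hx y hy, hg' x' hx' y' hy', h]
  have hπa : ∀ a ∈ A, ∀ i j, inner 𝕜 (g' 1 i)
      ((π a : EuclideanSpace 𝕜 (Fin (E.card * k)) →L[𝕜] _) (g' 1 j)) =
      w a i j + starRingEnd 𝕜 (w a⁻¹ j i) := by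
    intro a ha i j
    obtain ⟨x, hx, y, hy, rfl⟩ := hA' a ha
    rw [← hg' x hx y hy, ← hπ x hx, ← hπ y hy, map_mul, Submonoid.coe_mul, mul_apply_eq_comp,
      map_inv, ← Unitary.star_eq_inv, Unitary.coe_star, ContinuousLinearMap.star_eq_adjoint,
      ContinuousLinearMap.adjoint_inner_right]
  -- The nonnegative quantity here will turn out to be `2 * re (φ c)`, which the separation made
  -- negative; the second half comes from `a ↦ a⁻¹` and the hermitian symmetry of `c`.
  have hfin := hpos π (g' 1)
  have hφc' : φ (fun t => c t.1 t.2.1 t.2.2) = ∑ a ∈ A, ∑ i, ∑ j, c a i j * w a i j := by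
    rw [hw]
    exact Finset.sum_coe_sort A fun a => ∑ i, ∑ j, c a i j * w a i j
  have hconj : ∑ a ∈ A, ∑ i, ∑ j, c a i j * starRingEnd 𝕜 (w a⁻¹ j i) =
      starRingEnd 𝕜 (∑ a ∈ A, ∑ i, ∑ j, c a i j * w a i j) := by
    simp only [map_sum, map_mul, ← hc]
    refine Finset.sum_nbij' (fun a => a⁻¹) (fun a => a⁻¹) hinvA hinvA (by simp) (by simp)
      fun a _ => ?_
    rw [Finset.sum_comm]
    simp
  rw [Finset.sum_congr rfl fun a ha => Finset.sum_congr rfl fun i _ => Finset.sum_congr rfl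
    fun j _ => by rw [hπa a ha i j, mul_add]] at hfin
  simp only [Finset.sum_add_distrib] at hfin
  rw [hconj, map_add, RCLike.conj_re, ← hφc'] at hfin
  linarith

end

/-! ### Factorization with operator coefficients -/

theorem groupAlgebra_star_mul_self_sum {R G ι : Type*} [Semiring R] [StarRing R] [Group G]
    [Fintype ι] (x : ι → G) (B : ι → R) :
    star (∑ i, MonoidAlgebra.single (x i) (B i)) * ∑ i, MonoidAlgebra.single (x i) (B i) =
      ∑ i, ∑ j, MonoidAlgebra.single ((x i)⁻¹ * x j) (star (B i) * B j) := by
  rw [star_sum, Finset.sum_mul_sum]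
  simp only [groupAlgebra_star_single, MonoidAlgebra.single_mul_single]

section

variable {𝕜 G H : Type*} [RCLike 𝕜] [Group G] [NormedAddCommGroup H] [InnerProductSpace 𝕜 H]

theorem inner_evalRep_sum_tmul {K ι : Type*} [NormedAddCommGroup K]
    [InnerProductSpace 𝕜 K] [CompleteSpace K] [Fintype ι] (π : G →* unitary (K →L[𝕜] K))
    (f : MonoidAlgebra (H →L[𝕜] H) G) (e : ι → H) (u : ι → K) :
    inner 𝕜 (∑ i, e i ⊗ₜ[𝕜] u i) (evalRep π f (∑ i, e i ⊗ₜ[𝕜] u i)) =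
      ∑ a ∈ f.coeff.support, ∑ i, ∑ j,
        inner 𝕜 (e i) (f.coeff a (e j)) * inner 𝕜 (u i) ((π a : K →L[𝕜] K) (u j)) := by
  simp only [evalRep, LinearMap.sum_apply, map_sum, TensorProduct.map_tmul, inner_sum, sum_inner,
    TensorProduct.inner_tmul, ContinuousLinearMap.coe_coe]
  rw [Finset.sum_comm]
  exact Finset.sum_congr rfl fun a _ => Finset.sum_comm

theorem IsSelfAdjoint.groupAlgebra_coeff_inv [CompleteSpace H] {f : MonoidAlgebra (H →L[𝕜] H) G}
    (hf : IsSelfAdjoint f) (a : G) : f.coeff a⁻¹ = star (f.coeff a) := by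
  conv_lhs => rw [← hf.star_eq, groupAlgebra_coeff_star, inv_inv]

end

theorem Finset.sum_comm_pairs {ι κ M : Type*} [Fintype ι] [Fintype κ] [AddCommMonoid M]
    (F : ι → ι → κ → κ → M) :
    ∑ x, ∑ y, ∑ i, ∑ j, F x y i j = ∑ i, ∑ j, ∑ x, ∑ y, F x y i j := by
  calc _ = ∑ x, ∑ i, ∑ y, ∑ j, F x y i j := Finset.sum_congr rfl fun x _ => Finset.sum_comm
    _ = ∑ i, ∑ x, ∑ y, ∑ j, F x y i j := Finset.sum_comm
    _ = ∑ i, ∑ x, ∑ j, ∑ y, F x y i j :=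
      Finset.sum_congr rfl fun i _ => Finset.sum_congr rfl fun x _ => Finset.sum_comm
    _ = _ := Finset.sum_congr rfl fun i _ => Finset.sum_comm

/-- The scalar case applied to the matrix of `f` in an orthonormal basis `e` of `P`. Testing
`evalRep π f` on the vectors `∑ e i ⊗ u i` gives exactly the required pairings, and `V x` projects
to `P` and then sends `e i` to `v x i`. -/
theorem IsRooted.exists_compression {𝕜 H : Type*} [RCLike 𝕜] [NormedAddCommGroup H]
    [InnerProductSpace 𝕜 H] [CompleteSpace H] {d : ℕ} {E : Finset (FreeGroup (Fin d))}
    (hE : IsRooted E) (A : Finset (FreeGroup (Fin d)))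
    (hA : ∀ x ∈ E, ∀ y ∈ E, x⁻¹ * y ∈ A) (hA' : ∀ a ∈ A, ∃ x ∈ E, ∃ y ∈ E, x⁻¹ * y = a)
    (f : MonoidAlgebra (H →L[𝕜] H) (FreeGroup (Fin d))) (hf : IsSelfAdjoint f)
    (hfA : f.coeff.support ⊆ A) (P : Submodule 𝕜 H) [FiniteDimensional 𝕜 P]
    (hpos : ∀ π : FreeGroup (Fin d) →*
        unitary (EuclideanSpace 𝕜 (Fin (E.card * Module.finrank 𝕜 P)) →L[𝕜]
          EuclideanSpace 𝕜 (Fin (E.card * Module.finrank 𝕜 P))), (evalRep π f).IsPositive) :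
    ∃ V : E → H →ₗ[𝕜] EuclideanSpace 𝕜 (E × Fin (Module.finrank 𝕜 P)),
      ∀ a ∈ A, ∀ h ∈ P, ∀ h' ∈ P, (∑ x : E, ∑ y : E,
        if (x : FreeGroup (Fin d))⁻¹ * y = a then inner 𝕜 (V x h) (V y h') else 0) =
          inner 𝕜 h (f.coeff a h') := by
  set e := stdOrthonormalBasis 𝕜 P
  obtain ⟨v, hv⟩ := hE.exists_gram A hA hA'
    (fun a i j => inner 𝕜 (e i : H) (f.coeff a (e j : H))) (fun a i j => by
      rw [hf.groupAlgebra_coeff_inv, ContinuousLinearMap.star_eq_adjoint,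
        ContinuousLinearMap.adjoint_inner_right, inner_conj_symm]) (fun π u => by
      have h1 := (hpos π).2 (∑ i, (e i : H) ⊗ₜ[𝕜] u i)
      rw [(hpos π).1, inner_evalRep_sum_tmul] at h1
      rwa [Finset.sum_subset hfA] at h1
      intro a _ ha
      rw [Finsupp.notMem_support_iff.1 ha]
      simp)
  refine ⟨fun x => ∑ i, (innerSL 𝕜 (e i : H)).toLinearMap.smulRight (v x i),
    fun a ha h hh h' hh' => ?_⟩
  have hexp : ∀ z ∈ P, z = ∑ i, inner 𝕜 (e i : H) z • (e i : H) := fun z hz => by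
    have := congrArg Subtype.val (e.sum_repr' ⟨z, hz⟩)
    simpa using this.symm
  have hrhs : inner 𝕜 h (f.coeff a h') = ∑ i, ∑ j, ∑ x : E, ∑ y : E,
      starRingEnd 𝕜 (inner 𝕜 (e i : H) h) * (inner 𝕜 (e j : H) h' *
        if (x : FreeGroup (Fin d))⁻¹ * y = a then inner 𝕜 (v x i) (v y j) else 0) := by
    conv_lhs => rw [hexp h hh, hexp h' hh']
    simp only [map_sum, map_smul, sum_inner, inner_sum, inner_smul_left, inner_smul_right,
      ← Finset.mul_sum, hv a ha]
    simp only [Finset.mul_sum]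
    rw [Finset.sum_comm]
    exact Finset.sum_congr rfl fun i _ => Finset.sum_congr rfl fun j _ => mul_left_comm _ _ _
  rw [hrhs, ← Finset.sum_comm_pairs]
  refine Finset.sum_congr rfl fun x _ => Finset.sum_congr rfl fun y _ => ?_
  split_ifs
  · simp only [LinearMap.sum_apply, LinearMap.smulRight_apply, ContinuousLinearMap.coe_coe,
      innerSL_apply_apply, sum_inner, inner_sum, inner_smul_left, inner_smul_right]
    rw [Finset.sum_comm]
    simp only [Finset.mul_sum]
    exact Finset.sum_congr rfl fun i _ => Finset.sum_congr rfl fun j _ => mul_left_comm _ _ _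
  · simp

/-- The compressions to spans of finite sets are glued by a limit along an ultrafilter finer than
inclusion. Only their Gram forms converge, as the target spaces vary, and the square root of the
limit form recovers operators on `H` itself. -/
theorem IsRooted.exists_factorization {𝕜 H : Type*} [RCLike 𝕜] [NormedAddCommGroup H]
    [InnerProductSpace 𝕜 H] [CompleteSpace H] {d : ℕ} {E : Finset (FreeGroup (Fin d))}
    (hE : IsRooted E) (A : Finset (FreeGroup (Fin d)))
    (hA : ∀ x ∈ E, ∀ y ∈ E, x⁻¹ * y ∈ A) (hA' : ∀ a ∈ A, ∃ x ∈ E, ∃ y ∈ E, x⁻¹ * y = a)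
    (f : MonoidAlgebra (H →L[𝕜] H) (FreeGroup (Fin d))) (hf : IsSelfAdjoint f)
    (hfA : f.coeff.support ⊆ A)
    (hpos : ∀ (P : Submodule 𝕜 H) [FiniteDimensional 𝕜 P] (π : FreeGroup (Fin d) →*
        unitary (EuclideanSpace 𝕜 (Fin (E.card * Module.finrank 𝕜 P)) →L[𝕜]
          EuclideanSpace 𝕜 (Fin (E.card * Module.finrank 𝕜 P)))), (evalRep π f).IsPositive) :
    ∃ ξ : E → MonoidAlgebra (H →L[𝕜] H) (FreeGroup (Fin d)),
      (∀ x, (ξ x).coeff.support ⊆ E) ∧ f = ∑ x, star (ξ x) * ξ x := by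
  classical
  have h1A : (1 : FreeGroup (Fin d)) ∈ A := by simpa using hA 1 hE.1 1 hE.1
  choose V hV using fun s : Finset H => hE.exists_compression A hA hA' f hf hfA
    (Submodule.span 𝕜 (s : Set H)) (hpos _)
  -- The identity at `a = 1` reads `∑ ‖V s x h‖ ^ 2 = ⟨h, f(1) h⟩`, which bounds all the `V s x`
  -- independently of `s`.
  have hVn : ∀ s : Finset H, ∀ h ∈ s, ∀ x, ‖V s x h‖ ≤ √‖f.coeff 1‖ * ‖h‖ := by
    intro s h hs x
    have h1 := congrArg RCLike.re (hV s 1 h1A h (Submodule.subset_span hs) h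
      (Submodule.subset_span hs))
    simp only [inv_mul_eq_one, Subtype.coe_inj, Finset.sum_ite_eq, Finset.mem_univ, if_true,
      map_sum, inner_self_eq_norm_sq] at h1
    have h2 : ‖V s x h‖ ^ 2 ≤ ‖f.coeff 1‖ * ‖h‖ ^ 2 := calc
      _ ≤ ∑ y, ‖V s y h‖ ^ 2 := Finset.single_le_sum (f := fun y => ‖V s y h‖ ^ 2)
          (fun _ _ => sq_nonneg _) (Finset.mem_univ x)
      _ ≤ ‖inner 𝕜 h (f.coeff 1 h)‖ := h1.trans_le (RCLike.re_le_norm _)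
      _ ≤ ‖h‖ * (‖f.coeff 1‖ * ‖h‖) := (norm_inner_le_norm _ _).trans
          (mul_le_mul_of_nonneg_left ((f.coeff 1).le_opNorm h) (norm_nonneg _))
      _ = _ := by ring
    calc ‖V s x h‖ = √(‖V s x h‖ ^ 2) := (Real.sqrt_sq (norm_nonneg _)).symm
      _ ≤ √(‖f.coeff 1‖ * ‖h‖ ^ 2) := Real.sqrt_le_sqrt h2
      _ = _ := by rw [Real.sqrt_mul (norm_nonneg _), Real.sqrt_sq (norm_nonneg _)]
  let l : Ultrafilter (Finset H) := Ultrafilter.of Filter.atTop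
  have hl : ∀ t : Finset H, ∀ᶠ s in (l : Filter (Finset H)), t ⊆ s := fun t =>
    (Ultrafilter.of_le Filter.atTop) (Filter.eventually_ge_atTop t)
  obtain ⟨S, -, hS⟩ := l.exists_isSelfAdjoint_tendsto_inner (𝕜 := 𝕜)
    (fun s => ∑ x, V s x ∘ₗ (PiLp.proj 2 (𝕜 := 𝕜) (fun _ : E => H) x).toLinearMap)
    (E.card * √‖f.coeff 1‖) (fun h => by
      filter_upwards [hl (Finset.univ.image fun x => h x)] with s hs
      rw [LinearMap.sum_apply]
      refine (norm_sum_le _ _).trans ?_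
      refine (Finset.sum_le_card_nsmul _ _ (√‖f.coeff 1‖ * ‖h‖) fun x _ => ?_).trans ?_
      · refine (hVn s (h x) (hs (Finset.mem_image_of_mem _ (Finset.mem_univ x))) x).trans ?_
        exact mul_le_mul_of_nonneg_left (PiLp.norm_apply_le h x) (Real.sqrt_nonneg _)
      · simp [mul_assoc])
  let inj : E → (H →L[𝕜] PiLp 2 fun _ : E => H) := fun x =>
    (PiLp.continuousLinearEquiv 2 𝕜 (fun _ : E => H)).symm.toContinuousLinearMap ∘L
      ContinuousLinearMap.single 𝕜 (fun _ : E => H) x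
  have hinj : ∀ (s : Finset H) x h, (∑ z, V s z ∘ₗ
      (PiLp.proj 2 (𝕜 := 𝕜) (fun _ : E => H) z).toLinearMap) (inj x h) = V s x h := by
    intro s x h
    rw [LinearMap.sum_apply, Finset.sum_eq_single x]
    · simp [inj]
    · intro z _ hz
      simp [inj, hz]
    · simp
  -- The block entries of `S` on `H^E`. Row `z` gives one `ξ`, so the number of squares is the
  -- cardinality of `E`.
  let B : E → E → (H →L[𝕜] H) := fun z x => PiLp.proj 2 (𝕜 := 𝕜) (fun _ : E => H) z ∘L S ∘L inj x
  refine ⟨fun z => ∑ x : E, MonoidAlgebra.single (x : FreeGroup (Fin d)) (B z x),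
    fun z a ha => ?_, ?_⟩
  · by_contra haE
    refine (Finsupp.mem_support_iff.1 ha) ?_
    rw [MonoidAlgebra.coeff_sum, Finsupp.finsetSum_apply]
    refine Finset.sum_eq_zero fun x _ => ?_
    rw [MonoidAlgebra.coeff_single, Finsupp.single_apply, if_neg]
    rintro rfl
    exact haE x.2
  ext a h'
  refine ext_inner_left 𝕜 fun h => ?_
  have hlim := tendsto_finsetSum Finset.univ fun (x : E) _ => tendsto_finsetSum Finset.univ fun (y : E) _ =>
    (show Filter.Tendsto (fun s => if (x : FreeGroup (Fin d))⁻¹ * y = a then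
        inner 𝕜 (V s x h) (V s y h') else 0) l
      (nhds (if (x : FreeGroup (Fin d))⁻¹ * y = a then
        inner 𝕜 (S (inj x h)) (S (inj y h')) else 0)) by
      split_ifs
      · simpa only [hinj] using hS (inj x h) (inj y h')
      · exact tendsto_const_nhds)
  have hrhs : inner 𝕜 h ((∑ z, star (∑ x : E, MonoidAlgebra.single (x : FreeGroup (Fin d)) (B z x))
      * ∑ x : E, MonoidAlgebra.single (x : FreeGroup (Fin d)) (B z x)).coeff a h') =
      ∑ x : E, ∑ y : E, if (x : FreeGroup (Fin d))⁻¹ * y = a then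
        inner 𝕜 (S (inj x h)) (S (inj y h')) else 0 := by
    simp only [groupAlgebra_star_mul_self_sum, MonoidAlgebra.coeff_sum, Finsupp.finsetSum_apply,
      MonoidAlgebra.coeff_single, Finsupp.single_apply, sum_apply, inner_sum]
    rw [Finset.sum_comm]
    refine Finset.sum_congr rfl fun x _ => ?_
    rw [Finset.sum_comm]
    refine Finset.sum_congr rfl fun y _ => ?_
    split_ifs
    · rw [PiLp.inner_apply]
      refine Finset.sum_congr rfl fun z _ => ?_
      rw [mul_apply_eq_comp, ContinuousLinearMap.star_eq_adjoint,
        ContinuousLinearMap.adjoint_inner_right]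
      rfl
    · simp
  refine Eq.trans ?_ hrhs.symm
  refine tendsto_nhds_unique ?_ hlim
  refine tendsto_const_nhds.congr' ?_
  filter_upwards [hl {h, h'}] with s hs
  by_cases ha : a ∈ A
  · exact (hV s a ha h (Submodule.subset_span (hs (by simp))) h'
      (Submodule.subset_span (hs (by simp)))).symm
  · rw [Finsupp.notMem_support_iff.1 fun h => ha (hfA h)]
    symm
    rw [zero_apply, inner_zero_right]
    refine Finset.sum_eq_zero fun x _ => Finset.sum_eq_zero fun y _ => if_neg ?_
    rintro rfl
    exact ha (hA x x.2 y y.2)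

/-- The support of `f` is finite, so finitely many points of `E` account for it; a finite rooted
subset of `E` containing them does the work. -/
theorem IsGrounded.exists_sum_star_mul_self {𝕜 H : Type*} [RCLike 𝕜] [NormedAddCommGroup H]
    [InnerProductSpace 𝕜 H] [CompleteSpace H] {d : ℕ}
    {f : MonoidAlgebra (H →L[𝕜] H) (FreeGroup (Fin d))} {E : Set (FreeGroup (Fin d))}
    (hf : IsSelfAdjoint f) (hE : IsGrounded E)
    (hfE : (f.coeff.support : Set (FreeGroup (Fin d))) ⊆ E⁻¹ * E)
    (hpos : ∀ (m : ℕ) (π : FreeGroup (Fin d) →*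
        unitary (EuclideanSpace 𝕜 (Fin m) →L[𝕜] EuclideanSpace 𝕜 (Fin m))),
      (m : ℕ∞) ≤ 2 * E.encard * Cardinal.toENat (Module.rank 𝕜 H) → (evalRep π f).IsPositive) :
    ∃ n : ℕ, (n : ℕ∞) ≤ E.encard ∧
      ∃ ξ : Fin n → MonoidAlgebra (H →L[𝕜] H) (FreeGroup (Fin d)),
        (∀ i, ((ξ i).coeff.support : Set (FreeGroup (Fin d))) ⊆ E) ∧
        f = ∑ i, star (ξ i) * ξ i := by
  classical
  have hex : ∀ a : f.coeff.support, ∃ x ∈ E, ∃ y ∈ E, x⁻¹ * y = a := fun a => by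
    obtain ⟨x, hx, y, hy, hxy⟩ := Set.mem_mul.1 (hfE a.2)
    exact ⟨x⁻¹, hx, y, hy, by rw [inv_inv, hxy]⟩
  choose x hx y hy hxy using hex
  obtain ⟨E', hE', hB, hE'E⟩ := hE.exists_isRooted
    (Finset.univ.image x ∪ Finset.univ.image y) (by
      intro z hz
      simp only [Finset.coe_union, Finset.coe_image, Finset.coe_univ, Set.image_univ,
        Set.mem_union, Set.mem_range] at hz
      rcases hz with ⟨a, rfl⟩ | ⟨a, rfl⟩
      exacts [hx a, hy a])
  have hcard : (E'.card : ℕ∞) ≤ E.encard := by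
    rw [← Set.encard_coe_eq_coe_finsetCard]
    exact Set.encard_le_encard hE'E
  have hA : ∀ a, a ∈ (E' ×ˢ E').image (fun p => p.1⁻¹ * p.2) ↔ ∃ x ∈ E', ∃ y ∈ E', x⁻¹ * y = a := by
    intro a
    simp only [Finset.mem_image, Finset.mem_product, Prod.exists]
    exact ⟨fun ⟨x, y, h, e⟩ => ⟨x, h.1, y, h.2, e⟩, fun ⟨x, h, y, h', e⟩ => ⟨x, y, ⟨h, h'⟩, e⟩⟩
  obtain ⟨ξ, hξ, hsum⟩ := hE'.exists_factorization _
    (fun x hx y hy => (hA _).2 ⟨x, hx, y, hy, rfl⟩) (fun a ha => (hA a).1 ha) f hf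
    (fun a ha => (hA a).2 ⟨x ⟨a, ha⟩, hB (by simp), y ⟨a, ha⟩, hB (by simp), hxy _⟩)
    (fun P _ π => hpos _ π (by
      have hrank : (Module.finrank 𝕜 P : ℕ∞) ≤ Cardinal.toENat (Module.rank 𝕜 H) := by
        rw [← Cardinal.toENat_nat, Module.finrank_eq_rank]
        exact Cardinal.toENat.monotone' (Submodule.rank_le P)
      rw [Nat.cast_mul]
      refine mul_le_mul' (hcard.trans ?_) hrank
      -- The representations needed have dimension at most `|E| dim H`, so the factor `2` is slack.
      rw [two_mul]
      exact le_self_add))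
  refine ⟨E'.card, hcard, ξ ∘ E'.equivFin.symm, fun i => ?_, ?_⟩
  · exact (Finset.coe_subset.2 (hξ _)).trans hE'E
  · rw [hsum]
    exact (E'.equivFin.symm.sum_comp fun x => star (ξ x) * ξ x).symm

/-- With `η = ∑ Wᵢ ξᵢ`, orthogonality of the ranges kills the cross terms. The `Wᵢ` sit at the unit,
so no new support appears. -/
theorem exists_star_mul_self_eq_sum {𝕜 G H : Type*} [RCLike 𝕜] [Group G] [NormedAddCommGroup H]
    [InnerProductSpace 𝕜 H] [CompleteSpace H] (hH : ¬ FiniteDimensional 𝕜 H) {n : ℕ}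
    (ξ : Fin n → MonoidAlgebra (H →L[𝕜] H) G) (E : Set G)
    (hξ : ∀ i, ((ξ i).coeff.support : Set G) ⊆ E) :
    ∃ η : MonoidAlgebra (H →L[𝕜] H) G, (η.coeff.support : Set G) ⊆ E ∧
      ∑ i, star (ξ i) * ξ i = star η * η := by
  obtain ⟨W, hW⟩ := exists_isometries_of_not_finiteDimensional hH n
  refine ⟨∑ i, MonoidAlgebra.single 1 (W i) * ξ i, fun a ha => ?_, ?_⟩
  · by_contra haE
    refine (Finsupp.mem_support_iff.1 ha) ?_
    rw [MonoidAlgebra.coeff_sum, Finsupp.finsetSum_apply]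
    refine Finset.sum_eq_zero fun i _ => ?_
    rw [MonoidAlgebra.coeff_single_one_mul, Finsupp.notMem_support_iff.1 fun h => haE (hξ i h),
      mul_zero]
  · rw [star_sum, Finset.sum_mul_sum]
    refine Finset.sum_congr rfl fun i _ => ?_
    have h1 : ∀ j, star (MonoidAlgebra.single 1 (W i) * ξ i) * (MonoidAlgebra.single 1 (W j) * ξ j)
        = if i = j then star (ξ i) * ξ i else 0 := by
      intro j
      rw [star_mul, mul_assoc, ← mul_assoc _ _ (ξ j), groupAlgebra_star_single, inv_one,
        MonoidAlgebra.single_mul_single, hW, mul_one]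
      split_ifs with h
      · rw [← MonoidAlgebra.one_def, one_mul, h]
      · simp
    simp only [h1, Finset.sum_ite_eq, Finset.mem_univ, if_true]

/-! ### Evaluation at a unitary representation respects products and adjoints -/

section

variable {𝕜 G H K : Type*} [RCLike 𝕜] [Group G] [NormedAddCommGroup H] [InnerProductSpace 𝕜 H]
  [NormedAddCommGroup K] [InnerProductSpace 𝕜 K] [CompleteSpace K] (π : G →* unitary (K →L[𝕜] K))

theorem evalRep_eq_sum (f : MonoidAlgebra (H →L[𝕜] H) G) :
    evalRep π f = f.coeff.sum fun a A =>
      TensorProduct.map (A : H →ₗ[𝕜] H) ((π a : K →L[𝕜] K) : K →ₗ[𝕜] K) := rfl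

theorem evalRep_zero : evalRep π (0 : MonoidAlgebra (H →L[𝕜] H) G) = 0 := by
  simp [evalRep]

theorem evalRep_add (f g : MonoidAlgebra (H →L[𝕜] H) G) :
    evalRep π (f + g) = evalRep π f + evalRep π g := by
  simp only [evalRep_eq_sum, MonoidAlgebra.coeff_add]
  exact Finsupp.sum_add_index' (fun a => by simp)
    (fun a A B => by rw [ContinuousLinearMap.toLinearMap_add, TensorProduct.map_add_left])

theorem evalRep_single (a : G) (A : H →L[𝕜] H) :
    evalRep π (MonoidAlgebra.single a A) =
      TensorProduct.map (A : H →ₗ[𝕜] H) ((π a : K →L[𝕜] K) : K →ₗ[𝕜] K) := by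
  rw [evalRep_eq_sum, MonoidAlgebra.coeff_single]
  exact Finsupp.sum_single_index (by simp)

theorem evalRep_mul (f g : MonoidAlgebra (H →L[𝕜] H) G) :
    evalRep π (f * g) = evalRep π f ∘ₗ evalRep π g := by
  induction f using MonoidAlgebra.induction_linear with
  | zero => simp [evalRep_zero]
  | add f₁ f₂ h₁ h₂ => rw [add_mul, evalRep_add, h₁, h₂, evalRep_add, LinearMap.add_comp]
  | single a A =>
    induction g using MonoidAlgebra.induction_linear with
    | zero => simp [evalRep_zero]
    | add g₁ g₂ h₁ h₂ => rw [mul_add, evalRep_add, h₁, h₂, evalRep_add, LinearMap.comp_add]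
    | single b B =>
      rw [MonoidAlgebra.single_mul_single, evalRep_single, evalRep_single, evalRep_single,
        ← TensorProduct.map_comp, map_mul]
      rfl

theorem inner_evalRep_star [CompleteSpace H] (f : MonoidAlgebra (H →L[𝕜] H) G) (s t : H ⊗[𝕜] K) :
    inner 𝕜 (evalRep π (star f) s) t = inner 𝕜 s (evalRep π f t) := by
  induction f using MonoidAlgebra.induction_linear with
  | zero => simp [evalRep_zero]
  | add f₁ f₂ h₁ h₂ =>
    rw [star_add, evalRep_add, evalRep_add, LinearMap.add_apply, LinearMap.add_apply,
      inner_add_left, inner_add_right, h₁, h₂]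
  | single a A =>
    rw [groupAlgebra_star_single, evalRep_single, evalRep_single]
    induction s using TensorProduct.induction_on with
    | zero => simp
    | add s₁ s₂ h₁ h₂ => rw [map_add, inner_add_left, inner_add_left, h₁, h₂]
    | tmul h u =>
      induction t using TensorProduct.induction_on with
      | zero => simp
      | add t₁ t₂ h₁ h₂ => rw [map_add, inner_add_right, inner_add_right, h₁, h₂]
      | tmul h' u' =>
        simp only [TensorProduct.map_tmul, TensorProduct.inner_tmul, ContinuousLinearMap.coe_coe]
        rw [map_inv, ← Unitary.star_eq_inv, Unitary.coe_star, ContinuousLinearMap.star_eq_adjoint,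
          ContinuousLinearMap.star_eq_adjoint, ContinuousLinearMap.adjoint_inner_left,
          ContinuousLinearMap.adjoint_inner_left]

theorem re_inner_evalRep_star_mul_self_nonneg [CompleteSpace H]
    (f : MonoidAlgebra (H →L[𝕜] H) G) (t : H ⊗[𝕜] K) :
    0 ≤ RCLike.re (inner 𝕜 (evalRep π (star f * f) t) t) := by
  rw [evalRep_mul, LinearMap.comp_apply, inner_evalRep_star]
  exact inner_self_nonneg

end

/-! ### Scalar coefficients and the archimedean closure -/

section

variable (𝕜 G : Type*) [RCLike 𝕜] [Group G]

/-- The group algebra with scalar coefficients, inside the one with coefficients in the operators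
on the one-dimensional Hilbert space. -/
noncomputable def scalarToOperator : MonoidAlgebra 𝕜 G →+* MonoidAlgebra (𝕜 →L[𝕜] 𝕜) G :=
  MonoidAlgebra.mapRingHom G (algebraMap 𝕜 (𝕜 →L[𝕜] 𝕜))

variable {𝕜 G}

theorem scalarToOperator_star (f : MonoidAlgebra 𝕜 G) :
    scalarToOperator 𝕜 G (star f) = star (scalarToOperator 𝕜 G f) := by
  refine MonoidAlgebra.ext (Finsupp.ext fun s => ?_)
  simp only [scalarToOperator, MonoidAlgebra.coeff_mapRingHom, groupAlgebra_coeff_star]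
  exact algebraMap_star_comm _

/-- An operator on the line is multiplication by its value at `1`. Surjectivity is what brings the
squares back to scalar coefficients. -/
theorem scalarToOperator_bijective : Function.Bijective (scalarToOperator 𝕜 G) := by
  have halg : ∀ A : 𝕜 →L[𝕜] 𝕜, algebraMap 𝕜 (𝕜 →L[𝕜] 𝕜) (A 1) = A := fun A => by
    ext; simp [Algebra.algebraMap_eq_smul_one]
  refine ⟨fun f g h => ?_, fun g => ⟨.ofCoeff (g.coeff.mapRange (fun A => A 1) rfl), ?_⟩⟩
  · ext s
    have := congrArg (fun q => q.coeff s) h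
    simp only [scalarToOperator, MonoidAlgebra.coeff_mapRingHom] at this
    exact (algebraMap 𝕜 (𝕜 →L[𝕜] 𝕜)).injective this
  · refine MonoidAlgebra.ext (Finsupp.ext fun s => ?_)
    simp [scalarToOperator, halg]

theorem evalRep_scalarToOperator_smul_one {K : Type*} [NormedAddCommGroup K]
    [InnerProductSpace 𝕜 K] [CompleteSpace K] (π : G →* unitary (K →L[𝕜] K)) (c : 𝕜) :
    evalRep π (scalarToOperator 𝕜 G (c • 1)) = c • LinearMap.id := by
  have h : scalarToOperator 𝕜 G (c • 1) = MonoidAlgebra.single 1 (c • 1) := by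
    refine MonoidAlgebra.ext (Finsupp.ext fun s => ?_)
    simp only [scalarToOperator, MonoidAlgebra.coeff_mapRingHom, MonoidAlgebra.one_def,
      MonoidAlgebra.coeff_smul, MonoidAlgebra.coeff_single, Finsupp.smul_apply]
    by_cases hs : 1 = s
    · simp [hs, Algebra.algebraMap_eq_smul_one]
    · simp [hs]
  rw [h, evalRep_single, map_one, ContinuousLinearMap.toLinearMap_smul, TensorProduct.map_smul_left]
  exact congrArg _ TensorProduct.map_id

theorem sosCone_subset_archClosure :
    sosCone (MonoidAlgebra 𝕜 G) ⊆ archClosure 𝕜 (sosCone (MonoidAlgebra 𝕜 G)) := by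
  rintro _ ⟨n, ξ, rfl⟩
  refine ⟨by simp [isSelfAdjoint_iff, star_sum], fun ε hε => ?_⟩
  -- `ε 1` is itself the square of `√ε 1`.
  refine ⟨n + 1, Fin.cons (((√ε : ℝ) : 𝕜) • 1) ξ, ?_⟩
  rw [Fin.sum_univ_succ, add_comm]
  simp only [Fin.cons_zero, Fin.cons_succ]
  rw [MonoidAlgebra.one_def, MonoidAlgebra.smul_single, MonoidAlgebra.smul_single,
    groupAlgebra_star_single, MonoidAlgebra.single_mul_single]
  simp [← RCLike.ofReal_mul, Real.mul_self_sqrt hε.le]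

end

theorem isGrounded_univ (d : ℕ) : IsGrounded (Set.univ : Set (FreeGroup (Fin d))) := by
  have key : ∀ x y : FreeGroup (Fin d), ((freeCayleyGraph d).induce Set.univ).Reachable
      ⟨y, trivial⟩ ⟨x * y, trivial⟩ := by
    intro x
    induction x using FreeGroup.induction_on with
    | C1 => simp
    | of i =>
      exact fun y => SimpleGraph.Adj.reachable ⟨i, Or.inr (by simp)⟩
    | inv_of i _ =>
      exact fun y => SimpleGraph.Adj.reachable ⟨i, Or.inl (by simp)⟩
    | mul a b ha hb =>
      intro y
      rw [show (⟨a * b * y, trivial⟩ : (Set.univ : Set (FreeGroup (Fin d)))) =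
        ⟨a * (b * y), trivial⟩ from Subtype.ext (mul_assoc a b y)]
      exact (hb y).trans (ha (b * y))
  have : Nonempty (Set.univ : Set (FreeGroup (Fin d))) := ⟨⟨1, trivial⟩⟩
  refine ⟨trivial, ⟨fun x y => ?_⟩⟩
  simpa using key (y.1 * x.1⁻¹) x.1

/-- The squares for `a + ε 1` may vary without control in number and support. Only the positivity of
`a` in every finite-dimensional representation is kept, and the factorization with `H = 𝕜` and `E`
the whole group turns it back into squares. -/
theorem archClosure_sosCone_subset (𝕜 : Type*) [RCLike 𝕜] (d : ℕ) :
    archClosure 𝕜 (sosCone (MonoidAlgebra 𝕜 (FreeGroup (Fin d)))) ⊆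
      sosCone (MonoidAlgebra 𝕜 (FreeGroup (Fin d))) := by
  rintro a ⟨ha, hε⟩
  have hsa : IsSelfAdjoint (scalarToOperator 𝕜 _ a) := by
    rw [isSelfAdjoint_iff, ← scalarToOperator_star, ha.star_eq]
  obtain ⟨n, -, ξ, -, hξ⟩ := (isGrounded_univ d).exists_sum_star_mul_self hsa
    (fun s _ => ⟨1, trivial, s, trivial, one_mul s⟩) (fun m π _ => by
      refine ⟨fun s t => ?_, fun t => ?_⟩
      · rw [← inner_evalRep_star, hsa.star_eq]
      · refine le_of_forall_pos_le_add fun δ hδ => ?_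
        obtain ⟨ε, hε0, hεδ⟩ : ∃ ε : ℝ, 0 < ε ∧ ε * ‖t‖ ^ 2 ≤ δ := by
          -- The `+ 1` covers `t = 0`.
          refine ⟨δ / (‖t‖ ^ 2 + 1), by positivity, ?_⟩
          rw [div_mul_eq_mul_div, div_le_iff₀ (by positivity)]
          nlinarith
        obtain ⟨n, ξ, hξ⟩ := hε ε hε0
        have h1 : 0 ≤ RCLike.re (inner 𝕜 (evalRep π (scalarToOperator 𝕜 _
            (a + (ε : 𝕜) • (1 : MonoidAlgebra 𝕜 (FreeGroup (Fin d))))) t) t) := by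
          rw [hξ]
          clear hξ
          induction n with
          | zero => simp [evalRep_zero]
          | succ n ih =>
            rw [Fin.sum_univ_succ, map_add, evalRep_add, LinearMap.add_apply, inner_add_left,
              map_add, map_mul, scalarToOperator_star]
            exact add_nonneg (re_inner_evalRep_star_mul_self_nonneg π _ t) (ih _)
        rw [map_add, evalRep_add, evalRep_scalarToOperator_smul_one, LinearMap.add_apply,
          inner_add_left, map_add, LinearMap.smul_apply, LinearMap.id_apply, inner_smul_left,
          RCLike.conj_ofReal, RCLike.re_ofReal_mul, inner_self_eq_norm_sq] at h1
        linarith)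
  choose η hη using fun i => scalarToOperator_bijective.2 (ξ i)
  refine ⟨n, η, scalarToOperator_bijective.1 ?_⟩
  simp only [hξ, map_sum, map_mul, scalarToOperator_star, hη]

theorem mainTheorem4 (𝕜 : Type*) [RCLike 𝕜] (d : ℕ) :
    (∀ (H : Type*) [NormedAddCommGroup H] [InnerProductSpace 𝕜 H] [CompleteSpace H]
      (f : MonoidAlgebra (H →L[𝕜] H) (FreeGroup (Fin d))) (E : Set (FreeGroup (Fin d))),
      IsSelfAdjoint f → IsGrounded E → (f.coeff.support : Set (FreeGroup (Fin d))) ⊆ E⁻¹ * E →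
      (∀ (m : ℕ) (π : FreeGroup (Fin d) →*
          unitary (EuclideanSpace 𝕜 (Fin m) →L[𝕜] EuclideanSpace 𝕜 (Fin m))),
        (m : ℕ∞) ≤ 2 * E.encard * Cardinal.toENat (Module.rank 𝕜 H) →
        (evalRep π f).IsPositive) →
      (∃ n : ℕ, (n : ℕ∞) ≤ E.encard ∧
        ∃ ξ : Fin n → MonoidAlgebra (H →L[𝕜] H) (FreeGroup (Fin d)),
          (∀ i, ((ξ i).coeff.support : Set (FreeGroup (Fin d))) ⊆ E) ∧
          f = ∑ i, star (ξ i) * ξ i) ∧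
      (¬ FiniteDimensional 𝕜 H →
        ∃ ξ : MonoidAlgebra (H →L[𝕜] H) (FreeGroup (Fin d)),
          (ξ.coeff.support : Set (FreeGroup (Fin d))) ⊆ E ∧ f = star ξ * ξ)) ∧
    IsArchClosed 𝕜 (sosCone (MonoidAlgebra 𝕜 (FreeGroup (Fin d)))) := by
  refine ⟨fun H _ _ _ f E hf hE hfE hpos => ?_,
    sosCone_subset_archClosure.antisymm (archClosure_sosCone_subset 𝕜 d)⟩
  obtain ⟨n, hn, ξ, hξ, rfl⟩ := hE.exists_sum_star_mul_self hf hfE hpos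
  exact ⟨⟨n, hn, ξ, hξ, rfl⟩, fun hH => exists_star_mul_self_eq_sum hH ξ E hξ⟩
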